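/- All spaces are assumed to be Tychonoff (completely regular and Hausdorff). A function $f:X\to\mathbb{R}$ on a space $X$ is called $k$-continuous if its restriction to every compact subset of $X$ is continuous, and $X$ is called a $k_{\mathbb{R}}$-space if every $k$-continuous function $f:X\to\mathbb{R}$ is continuous. A space is pseudocompact if every continuous real-valued function on it is bounded, and a space is locally pseudocompact if each of its points has a neighborhood which, in the subspace topology, is a pseudocompact space. A space $X$ is Fréchet–Urysohn if, for every $A\subseteq X$, every point of the closure of $A$ is the limit of a sequence of points of $A$. **Theorem.** For a space $Y$ the following assertions are equivalent: (i) $Y$ is a locally pseudocompact $k_{\mathbb{R}}$-space; (ii) $X\times Y$ is a $k_{\mathbb{R}}$-space for every $k_{\mathbb{R}}$-space $X$; (iii) $X\times Y$ is a $k_{\mathbb{R}}$-space for every Fréchet–Urysohn space $X$. In particular, if $Y$ is locally compact, then $X\times Y$ is a $k_{\mathbb{R}}$-space for every $k_{\mathbb{R}}$-space $X$. -/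

import Mathlib

universe u

/-- A function `f : X → ℝ` is `k`-continuous if its restriction to every compact subset of `X`
is continuous. -/
def KContinuous {X : Type*} [TopologicalSpace X] (f : X → ℝ) : Prop :=
  ∀ K : Set X, IsCompact K → ContinuousOn f K

/-- `X` is a `k_ℝ`-space if every `k`-continuous real-valued function on `X` is continuous.
(The Tychonoff property is assumed separately, as `T35Space X`.) -/
def IsKRSpace (X : Type*) [TopologicalSpace X] : Prop :=
  ∀ f : X → ℝ, KContinuous f → Continuous f

/-- `X` is pseudocompact if every continuous real-valued function on `X` is bounded.
(The Tychonoff property is assumed separately, and passes to subspaces.) -/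
def IsPseudocompactSpace (X : Type*) [TopologicalSpace X] : Prop :=
  ∀ f : X → ℝ, Continuous f → ∃ C : ℝ, ∀ x : X, |f x| ≤ C

/-- `X` is locally pseudocompact if every point has a neighborhood which, with the subspace
topology, is a pseudocompact space. -/
def IsLocallyPseudocompactSpace (X : Type*) [TopologicalSpace X] : Prop :=
  ∀ x : X, ∃ U : Set X, U ∈ nhds x ∧ IsPseudocompactSpace U

open Set Filter Topology

/-! ### Pseudocompactness: metric images and bump functions -/

section PseudocompactSpaces

/-! For (i) ⇒ (ii), let `f` be `k`-continuous on `X × Y` and `U` a pseudocompact neighborhood in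
`Y`. The map `x ↦ f (x, ·)` into bounded continuous functions on `U` is norm continuous on compacta
(`KContinuous.eventually_forall_abs_sub_lt`), since metric images of `U` are totally bounded; hence
it is continuous on the `k_ℝ`-space `X`. For (iii) ⇒ (i), if `y` has no pseudocompact neighborhood,
every open `O ∋ y` carries a locally finite sequence of bumps. Placed along the spines of a fan
indexed by these `O`, they form a `k`-continuous function that is discontinuous at `(apex, y)`. -/

theorem IsPseudocompactSpace.of_compactSpace {X : Type*} [TopologicalSpace X] [CompactSpace X] :
    IsPseudocompactSpace X := by
  intro f hf
  obtain ⟨C, hC⟩ := isCompact_univ.exists_bound_of_continuousOn hf.continuousOn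
  exact ⟨C, fun x => hC x (mem_univ x)⟩

/-- Otherwise the image contains an `ε`-separated sequence, which is closed and discrete; a Tietze
extension of its numbering pulls back to an unbounded function. -/
theorem IsPseudocompactSpace.totallyBounded_range {X Z : Type*} [TopologicalSpace X]
    [MetricSpace Z] (hX : IsPseudocompactSpace X) {g : X → Z} (hg : Continuous g) :
    TotallyBounded (range g) := by
  by_contra h
  rw [Metric.totallyBounded_iff] at h
  push Not at h
  obtain ⟨ε, hε, h⟩ := h
  have hstep : ∀ t : Set X, t.Finite → ∃ x, ∀ y ∈ t, ε ≤ dist (g x) (g y) := by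
    intro t ht
    obtain ⟨_, ⟨x, rfl⟩, hx⟩ := not_subset.1 (h (g '' t) (ht.image g))
    refine ⟨x, fun y hy => ?_⟩
    by_contra! hlt
    exact hx (mem_biUnion (mem_image_of_mem g hy) hlt)
  obtain ⟨u, hu⟩ := seq_of_forall_finite_exists hstep
  have hsep : Pairwise fun m n => ε ≤ dist (g (u m)) (g (u n)) := by
    intro m n hmn
    rcases lt_or_gt_of_ne hmn with hlt | hlt
    · rw [dist_comm]
      exact hu n _ ⟨m, hlt, rfl⟩
    · exact hu m _ ⟨n, hlt, rfl⟩
  obtain ⟨F, hF⟩ := ContinuousMap.exists_extension (Y := ℝ)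
    (Metric.isClosedEmbedding_of_pairwise_le_dist hε hsep)
    ⟨fun n : ℕ => (n : ℝ), continuous_of_discreteTopology⟩
  obtain ⟨C, hC⟩ := hX (F ∘ g) (F.continuous.comp hg)
  obtain ⟨n, hn⟩ := exists_nat_gt C
  have hFn : F (g (u n)) = n := DFunLike.congr_fun hF n
  have := hC (u n)
  rw [Function.comp_apply, hFn, Nat.abs_cast] at this
  linarith

/-- If the closure of an open set is not pseudocompact, the set carries a locally finite sequence
of nonzero bump functions. -/
theorem exists_locallyFinite_bump_of_not_isPseudocompactSpace_closure {Y : Type*}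
    [TopologicalSpace Y] [CompletelyRegularSpace Y] {O : Set Y} (hO : IsOpen O)
    (h : ¬ IsPseudocompactSpace (closure O)) :
    ∃ b : ℕ → Y → ℝ, (∀ n, Continuous (b n)) ∧ (∀ n, ∃ y ∈ O, b n y = 1) ∧
      ∀ y, ∃ V ∈ 𝓝 y, ∀ᶠ n in atTop, ∀ z ∈ V, b n z = 0 := by
  unfold IsPseudocompactSpace at h
  push Not at h
  obtain ⟨g, hg, hunb⟩ := h
  have hex : ∀ n : ℕ, ∃ b : Y → ℝ, Continuous b ∧ (∃ y ∈ O, b y = 1) ∧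
      ∀ z, b z ≠ 0 → ∃ hz : z ∈ closure O, n < |g ⟨z, hz⟩| := by
    intro n
    obtain ⟨W, hW, hWg⟩ := isOpen_induced_iff.1 (isOpen_lt continuous_const hg.abs :
      IsOpen {z | (n : ℝ) < |g z|})
    have hmem (z : closure O) : (z : Y) ∈ W ↔ (n : ℝ) < |g z| := Set.ext_iff.1 hWg z
    obtain ⟨x, hx⟩ := hunb n
    -- Moving from `closure O` into `O` gives a set `W ∩ O` open in `Y`, so the bump is continuous
    -- on all of `Y`.
    obtain ⟨y, hyW, hyO⟩ := mem_closure_iff.1 x.2 W hW ((hmem x).2 hx)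
    obtain ⟨φ, hφ, hφy, hφK⟩ := CompletelyRegularSpace.completely_regular_isOpen y (W ∩ O)
      (hW.inter hO) ⟨hyW, hyO⟩
    refine ⟨fun z => 1 - (φ z : ℝ), by fun_prop, ⟨y, hyO, by simp [hφy]⟩, fun z hz => ?_⟩
    have hzWO : z ∈ W ∩ O := by
      by_contra hzn
      exact hz (by simp [hφK hzn])
    exact ⟨subset_closure hzWO.2, (hmem ⟨z, _⟩).1 hzWO.1⟩
  choose b hb hb1 hbs using hex
  refine ⟨b, hb, hb1, fun y => ?_⟩
  by_cases hy : y ∈ closure O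
  · obtain ⟨m, hm⟩ := exists_nat_gt |g ⟨y, hy⟩|
    obtain ⟨V, hV, hVg⟩ := (mem_nhds_subtype _ _ _).1
      ((isOpen_lt hg.abs continuous_const : IsOpen {z | |g z| < (m : ℝ)}).mem_nhds hm)
    refine ⟨V, hV, (eventually_ge_atTop m).mono fun n hn z hz => ?_⟩
    by_contra hne
    obtain ⟨hzO, hlt⟩ := hbs n z hne
    have h1 : |g ⟨z, hzO⟩| < m := hVg (a := ⟨z, hzO⟩) hz
    have h2 : (m : ℝ) ≤ n := by exact_mod_cast hn
    linarith
  · refine ⟨_, isClosed_closure.isOpen_compl.mem_nhds hy, Eventually.of_forall fun n z hz => ?_⟩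
    by_contra hne
    exact hz (hbs n z hne).1

end PseudocompactSpaces

/-! ### `k_ℝ`-spaces and their products -/

section KRSpaces

theorem KContinuous.comp_continuous {X Y : Type*} [TopologicalSpace X] [TopologicalSpace Y]
    {f : Y → ℝ} (hf : KContinuous f) {g : X → Y} (hg : Continuous g) : KContinuous (f ∘ g) :=
  fun K hK => (hf (g '' K) (hK.image hg)).comp hg.continuousOn (mapsTo_image g K)

/-- Real-valued functions detect continuity into a completely regular space. -/
theorem IsKRSpace.continuous_of_continuousOn {X Z : Type*} [TopologicalSpace X]
    [TopologicalSpace Z] [CompletelyRegularSpace Z] (hX : IsKRSpace X) {F : X → Z}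
    (hF : ∀ K : Set X, IsCompact K → ContinuousOn F K) : Continuous F := by
  refine continuous_iff_continuousAt.2 fun x U hU => ?_
  obtain ⟨O, hOU, hO, hxO⟩ := mem_nhds_iff.1 hU
  obtain ⟨φ, hφ, hφx, hφK⟩ := CompletelyRegularSpace.completely_regular_isOpen (F x) O hO hxO
  have hcont : Continuous fun z => (φ (F z) : ℝ) := hX _ fun K hK =>
    (continuous_subtype_val.comp hφ).comp_continuousOn (hF K hK)
  have hnear : ∀ᶠ z in 𝓝 x, (φ (F z) : ℝ) < 1 :=
    (isOpen_lt hcont continuous_const).mem_nhds (by simp [hφx])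
  refine hnear.mono fun z hz => hOU ?_
  by_contra hzO
  simp [hφK hzO] at hz

theorem IsKRSpace.of_sequentialSpace {X : Type*} [TopologicalSpace X] [SequentialSpace X] :
    IsKRSpace X := by
  intro f hf
  refine SeqContinuous.continuous fun u x hu => ?_
  have hK := hf _ hu.isCompact_insert_range
  exact (hK x (mem_insert _ _)).tendsto.comp (tendsto_nhdsWithin_iff.2
    ⟨hu, Eventually.of_forall fun n => mem_insert_of_mem _ (mem_range_self n)⟩)

theorem IsKRSpace.of_weaklyLocallyCompactSpace {X : Type*} [TopologicalSpace X]
    [WeaklyLocallyCompactSpace X] : IsKRSpace X := by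
  intro f hf
  refine continuous_iff_continuousAt.2 fun x => ?_
  obtain ⟨K, hK, hx⟩ := exists_compact_mem_nhds x
  exact (hf K hK).continuousAt hx

theorem IsLocallyPseudocompactSpace.of_weaklyLocallyCompactSpace {X : Type*} [TopologicalSpace X]
    [WeaklyLocallyCompactSpace X] : IsLocallyPseudocompactSpace X := by
  intro x
  obtain ⟨K, hK, hx⟩ := exists_compact_mem_nhds x
  have := isCompact_iff_compactSpace.1 hK
  exact ⟨K, hx, .of_compactSpace⟩

/-- A `k`-continuous function on `X × Y` is equicontinuous along compact subsets of `X`, uniformly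
over a pseudocompact subspace of the `k_ℝ`-space `Y`. -/
theorem KContinuous.eventually_forall_abs_sub_lt {X Y : Type*} [TopologicalSpace X]
    [TopologicalSpace Y] (hY : IsKRSpace Y) {f : X × Y → ℝ} (hf : KContinuous f) {U : Set Y}
    (hU : IsPseudocompactSpace U) {K : Set X} (hK : IsCompact K) {a : X} (ha : a ∈ K) {ε : ℝ}
    (hε : 0 < ε) : ∀ᶠ x in 𝓝[K] a, ∀ y ∈ U, |f (x, y) - f (a, y)| < ε := by
  have := isCompact_iff_compactSpace.1 hK
  have hslice (y : Y) : Continuous fun x : K => f (x, y) :=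
    continuousOn_univ.1 ((hf.comp_continuous (g := fun x : K => ((x : X), y)) (by fun_prop)) univ
      isCompact_univ)
  -- With `Y` as parameter space, `Ψ` maps `U` onto a totally bounded family in `C(K, ℝ)`; a finite
  -- `ε / 3`-net makes it equicontinuous at `a`.
  let Ψ : Y → C(K, ℝ) := fun y => ⟨fun x => f (x, y), hslice y⟩
  have hΨ : Continuous Ψ := by
    refine hY.continuous_of_continuousOn fun L hL => ?_
    rw [continuousOn_iff_continuous_domRestrict]
    refine ContinuousMap.continuous_of_continuous_uncurry _ ?_
    exact (hf (K ×ˢ L) (hK.prod hL)).comp_continuous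
      (f := fun p : L × K => ((p.2 : X), (p.1 : Y))) (by fun_prop) fun p => ⟨p.2.2, p.1.2⟩
  have htb := hU.totallyBounded_range (hΨ.comp continuous_subtype_val)
  obtain ⟨t, ht, hcov⟩ := Metric.totallyBounded_iff.1 htb (ε / 3) (by positivity)
  have hev : ∀ᶠ x : K in 𝓝 ⟨a, ha⟩, ∀ ψ ∈ t, dist (ψ x) (ψ ⟨a, ha⟩) < ε / 3 :=
    (eventually_all_finite ht).2 fun ψ _ =>
      Metric.tendsto_nhds.1 ψ.continuous.continuousAt _ (by positivity)
  rw [nhdsWithin_eq_map_subtype_coe ha, eventually_map]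
  refine hev.mono fun x hx y hy => ?_
  obtain ⟨ψ, hψ, hd⟩ := mem_iUnion₂.1 (hcov ⟨⟨y, hy⟩, rfl⟩)
  have h1 : dist (f (x, y)) (ψ x) < ε / 3 := (ContinuousMap.dist_apply_le_dist x).trans_lt hd
  have h2 : dist (f (a, y)) (ψ ⟨a, ha⟩) < ε / 3 :=
    (ContinuousMap.dist_apply_le_dist (⟨a, ha⟩ : K)).trans_lt hd
  have h3 := hx ψ hψ
  rw [← Real.dist_eq]
  rw [dist_comm] at h2
  linarith [dist_triangle4 (f (x, y)) (ψ x) (ψ ⟨a, ha⟩) (f (a, y))]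

theorem IsKRSpace.prod {X Y : Type*} [TopologicalSpace X] [TopologicalSpace Y]
    (hX : IsKRSpace X) (hY : IsKRSpace Y) (hloc : IsLocallyPseudocompactSpace Y) :
    IsKRSpace (X × Y) := by
  intro f hf
  have hslice (x : X) : Continuous fun y => f (x, y) :=
    hY _ (hf.comp_continuous (g := fun y => (x, y)) (by fun_prop))
  refine continuous_iff_continuousAt.2 fun ⟨a, b⟩ => ?_
  obtain ⟨U, hUb, hU⟩ := hloc b
  let Φ : X → BoundedContinuousFunction U ℝ := fun x =>
    BoundedContinuousFunction.ofNormedAddCommGroup (fun y : U => f (x, y))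
      ((hslice x).comp continuous_subtype_val)
      (hU _ ((hslice x).comp continuous_subtype_val)).choose
      (hU _ ((hslice x).comp continuous_subtype_val)).choose_spec
  have hΦ : Continuous Φ := by
    refine hX.continuous_of_continuousOn fun K hK x hx => Metric.tendsto_nhds.2 fun ε hε => ?_
    filter_upwards [hf.eventually_forall_abs_sub_lt hY hU hK hx (half_pos hε)] with z hz
    refine lt_of_le_of_lt ?_ (half_lt_self hε)
    exact (BoundedContinuousFunction.dist_le (half_pos hε).le).2 fun y => (hz y y.2).le
  refine Metric.tendsto_nhds.2 fun ε hε => ?_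
  have h1 : ∀ᶠ x in 𝓝 a, dist (Φ x) (Φ a) < ε / 2 :=
    Metric.tendsto_nhds.1 hΦ.continuousAt _ (half_pos hε)
  have h2 : ∀ᶠ y in 𝓝 b, dist (f (a, y)) (f (a, b)) < ε / 2 :=
    Metric.tendsto_nhds.1 (hslice a).continuousAt _ (half_pos hε)
  rw [nhds_prod_eq]
  filter_upwards [h1.prod_mk (h2.and hUb)] with ⟨x, y⟩ ⟨hx, hy, hyU⟩
  have h3 : dist (f (x, y)) (f (a, y)) < ε / 2 :=
    (BoundedContinuousFunction.dist_coe_le_dist (f := Φ x) (g := Φ a) ⟨y, hyU⟩).trans_lt hx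
  linarith [dist_triangle (f (x, y)) (f (a, y)) (f (a, b))]

theorem IsKRSpace.of_prod_punit {Y : Type*} [TopologicalSpace Y]
    (h : IsKRSpace (PUnit × Y)) : IsKRSpace Y := fun f hf =>
  (h (f ∘ Prod.snd) (hf.comp_continuous continuous_snd)).comp
    (by fun_prop : Continuous fun y : Y => (PUnit.unit, y))

end KRSpaces

/-! ### The sequential fan -/

/-- The sequential fan with spines indexed by `ι`: countably infinite convergent sequences, one for
each index, glued at their limit point `none`. -/
def SequentialFan (ι : Type*) : Type _ := Option (ι × ℕ)

namespace SequentialFan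

variable {ι : Type*}

/-- The common limit point of the spines. -/
def apex : SequentialFan ι := (none : Option (ι × ℕ))

/-- The `n`-th point of the `i`-th spine. -/
def mk (i : ι) (n : ℕ) : SequentialFan ι := (some (i, n) : Option (ι × ℕ))

theorem mk_ne_apex (i : ι) (n : ℕ) : mk i n ≠ apex := Option.some_ne_none _

theorem mk_inj {i j : ι} {m n : ℕ} : mk i m = mk j n ↔ i = j ∧ m = n :=
  (Option.some_inj (a := (i, m)) (b := (j, n))).trans Prod.mk_inj

theorem eq_apex_or_eq_mk (x : SequentialFan ι) : x = apex ∨ ∃ i n, x = mk i n :=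
  match x with
  | none => Or.inl rfl
  | some (i, n) => Or.inr ⟨i, n, rfl⟩

instance : TopologicalSpace (SequentialFan ι) :=
  nhdsAdjoint apex (⨆ i, map (mk i) atTop)

theorem mem_nhds_apex {s : Set (SequentialFan ι)} :
    s ∈ 𝓝 apex ↔ apex ∈ s ∧ ∀ i, ∀ᶠ n in atTop, mk i n ∈ s := by
  rw [nhds_nhdsAdjoint_same, mem_sup, mem_iSup]
  rfl

theorem nhds_of_ne {x : SequentialFan ι} (hx : x ≠ apex) : 𝓝 x = pure x :=
  nhds_nhdsAdjoint_of_ne _ hx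

theorem isOpen_of_apex_notMem {s : Set (SequentialFan ι)} (hs : apex ∉ s) : IsOpen s :=
  fun h => absurd h hs

theorem isClosed_singleton (x : SequentialFan ι) : IsClosed {x} := by
  refine ⟨isOpen_iff_mem_nhds.2 fun z hz => ?_⟩
  by_cases h : z = apex
  · subst h
    refine mem_nhds_apex.2 ⟨hz, fun i => ?_⟩
    rcases eq_apex_or_eq_mk x with rfl | ⟨j, m, rfl⟩
    · exact Eventually.of_forall fun n => mk_ne_apex i n
    · filter_upwards [eventually_gt_atTop m] with n hn heq
      exact hn.ne' (mk_inj.1 heq).2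
  · rw [nhds_of_ne h]
    exact hz

instance : T1Space (SequentialFan ι) := ⟨isClosed_singleton⟩

instance : CompletelyRegularSpace (SequentialFan ι) := by
  refine .of_isTopologicalBasis_clopens (TopologicalSpace.isTopologicalBasis_of_isOpen_of_nhds (fun s hs => hs.2)
    fun x U hx hU => ?_)
  by_cases h : x = apex
  · subst h
    exact ⟨U, ⟨⟨isOpen_of_apex_notMem fun hn => hn hx⟩, hU⟩, hx, Subset.rfl⟩
  · exact ⟨{x}, ⟨isClosed_singleton x, isOpen_of_apex_notMem fun hn => h hn.symm⟩, rfl,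
      singleton_subset_iff.2 hx⟩

instance : T35Space (SequentialFan ι) where

theorem tendsto_mk_apex (i : ι) : Tendsto (mk i) atTop (𝓝 apex) :=
  fun _ hs => (mem_nhds_apex.1 hs).2 i

instance : FrechetUrysohnSpace (SequentialFan ι) := by
  refine ⟨fun s x hx => ?_⟩
  by_cases hxs : x ∈ s
  · exact subset_seqClosure hxs
  by_cases h : x = apex
  · subst h
    have hfreq : ∃ i, ∃ᶠ n in atTop, mk i n ∈ s := by
      by_contra! hno
      refine mem_closure_iff_nhds.1 hx sᶜ (mem_nhds_apex.2 ⟨hxs, fun i => ?_⟩) |>.ne_empty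
        (compl_inter_self s)
      exact hno i
    obtain ⟨i, hi⟩ := hfreq
    obtain ⟨φ, hφ, hφs⟩ := extraction_of_frequently_atTop hi
    exact ⟨fun n => mk i (φ n), hφs, (tendsto_mk_apex i).comp hφ.tendsto_atTop⟩
  · rw [mem_closure_iff_nhds, nhds_of_ne h] at hx
    obtain ⟨z, hz, hzs⟩ := hx {x} rfl
    exact absurd (mem_singleton_iff.1 hz ▸ hzs) hxs

/-- A compact subset of a sequential fan meets only finitely many spines. -/
theorem finite_setOf_exists_mk_mem {K : Set (SequentialFan ι)} (hK : IsCompact K) :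
    {i | ∃ n, mk i n ∈ K}.Finite := by
  set S := {i | ∃ n, mk i n ∈ K}
  choose! N hN using fun i (hi : i ∈ S) => hi
  -- One point per spine: a tail of each spine avoids `D`, so all subsets of `D` are closed, and `D`
  -- is compact and discrete.
  let D := (fun i => mk i (N i)) '' S
  have hDclosed (T : Set (SequentialFan ι)) (hT : T ⊆ D) : IsClosed T := by
    refine ⟨isOpen_iff_mem_nhds.2 fun z hz => ?_⟩
    by_cases h : z = apex
    · subst h
      refine mem_nhds_apex.2 ⟨hz, fun i => ?_⟩
      filter_upwards [eventually_gt_atTop (N i)] with n hn hmem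
      obtain ⟨j, -, hj⟩ := hT hmem
      obtain ⟨rfl, rfl⟩ := mk_inj.1 hj
      exact lt_irrefl _ hn
    · rw [nhds_of_ne h]
      exact hz
  have hDK : D ⊆ K := image_subset_iff.2 hN
  have hD : IsCompact D := hK.of_isClosed_subset (hDclosed D Subset.rfl) hDK
  have hdisc : IsDiscrete D := ⟨discreteTopology_iff_forall_isClosed.2 fun T =>
    isClosed_induced_iff.2 ⟨_, hDclosed _ (Subtype.coe_image_subset D T),
      preimage_image_eq T Subtype.val_injective⟩⟩
  exact (hD.finite hdisc).of_finite_image fun i _ j _ hij => (mk_inj.1 hij).1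

/-- The function on `SequentialFan ι × Y` which vanishes over the apex and is `b i n` over the
`n`-th point of the `i`-th spine. -/
def glue {Y : Type*} (b : ι → ℕ → Y → ℝ) : SequentialFan ι × Y → ℝ
  | (none, _) => 0
  | (some (i, n), y) => b i n y

theorem glue_apex {Y : Type*} (b : ι → ℕ → Y → ℝ) (y : Y) : glue b (apex, y) = 0 := rfl

theorem glue_mk {Y : Type*} (b : ι → ℕ → Y → ℝ) (i : ι) (n : ℕ) (y : Y) :
    glue b (mk i n, y) = b i n y := rfl

/-- A compact set meets finitely many spines, so near the apex only finitely many of the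
neighborhoods from `hfin` need intersecting. -/
theorem kContinuous_glue {Y : Type*} [TopologicalSpace Y] {b : ι → ℕ → Y → ℝ}
    (hb : ∀ i n, Continuous (b i n))
    (hfin : ∀ i y, ∃ V ∈ 𝓝 y, ∀ᶠ n in atTop, ∀ z ∈ V, b i n z = 0) : KContinuous (glue b) := by
  rintro C hC ⟨x, y⟩ hxy
  rcases eq_apex_or_eq_mk x with rfl | ⟨i, n, rfl⟩
  · choose V hV hVb using fun i => hfin i y
    have hS := finite_setOf_exists_mk_mem (hC.image continuous_fst)
    set S := {i | ∃ n, mk i n ∈ Prod.fst '' C}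
    let W : Set (SequentialFan ι) :=
      {x | ∀ i n, x = mk i n → i ∈ S → ∀ z ∈ V i, b i n z = 0}
    have hW : W ∈ 𝓝 apex := by
      refine mem_nhds_apex.2 ⟨fun i n h => absurd h.symm (mk_ne_apex i n), fun i => ?_⟩
      filter_upwards [hVb i] with n hn j m hjm _
      obtain ⟨rfl, rfl⟩ := mk_inj.1 hjm
      exact hn
    have hzero : ∀ᶠ p in 𝓝[C] (apex, y), glue b p = 0 := by
      filter_upwards [self_mem_nhdsWithin, mem_nhdsWithin_of_mem_nhds
        (prod_mem_nhds hW ((biInter_mem hS).2 fun i _ => hV i))] with ⟨x, z⟩ hxz ⟨hx, hz⟩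
      rcases eq_apex_or_eq_mk x with rfl | ⟨i, n, rfl⟩
      · rfl
      · have hi : i ∈ S := ⟨n, _, hxz, rfl⟩
        exact hx i n rfl hi z (mem_iInter₂.1 hz i hi)
    exact tendsto_nhds_of_eventually_eq hzero
  · refine ContinuousAt.continuousWithinAt ?_
    refine ((hb i n).comp continuous_snd).continuousAt.congr ?_
    rw [nhds_prod_eq, nhds_of_ne (mk_ne_apex i n), pure_prod]
    exact eventually_map.2 (Eventually.of_forall fun z => rfl)

end SequentialFan

/-! ### Necessity of local pseudocompactness, and the equivalence -/

theorem IsLocallyPseudocompactSpace.of_isKRSpace_prod_sequentialFan {Y : Type*}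
    [TopologicalSpace Y] [CompletelyRegularSpace Y]
    (h : ∀ y : Y, IsKRSpace (SequentialFan {O : Set Y // IsOpen O ∧ y ∈ O} × Y)) :
    IsLocallyPseudocompactSpace Y := by
  intro y
  by_contra! hy
  have hex (O : {O : Set Y // IsOpen O ∧ y ∈ O}) :=
    exists_locallyFinite_bump_of_not_isPseudocompactSpace_closure O.2.1
      (hy _ (mem_of_superset (O.2.1.mem_nhds O.2.2) subset_closure))
  choose b hb hb1 hfin using hex
  have hcont := h y _ (SequentialFan.kContinuous_glue hb hfin)
  have hnear : ∀ᶠ p in 𝓝 (SequentialFan.apex, y), SequentialFan.glue b p < 1 :=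
    (isOpen_lt hcont continuous_const).mem_nhds
      (by simp [SequentialFan.glue_apex])
  obtain ⟨W, hW, V, hV, hWV⟩ := mem_nhds_prod_iff.1 hnear
  -- The spine indexed by an `O ⊆ V` enters `W`, and its bumps take the value `1` over `O`.
  obtain ⟨O, hOV, hO, hyO⟩ := mem_nhds_iff.1 hV
  obtain ⟨n, hn⟩ := ((SequentialFan.mem_nhds_apex.1 hW).2 ⟨O, hO, hyO⟩).exists
  obtain ⟨z, hzO, hz⟩ := hb1 ⟨O, hO, hyO⟩ n
  have : SequentialFan.glue b (SequentialFan.mk ⟨O, hO, hyO⟩ n, z) < 1 :=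
    hWV (mk_mem_prod hn (hOV hzO))
  rw [SequentialFan.glue_mk, hz] at this
  exact lt_irrefl _ this

theorem theorem4p7 (Y : Type u) [TopologicalSpace Y] [T35Space Y] :
    List.TFAE [
      IsLocallyPseudocompactSpace Y ∧ IsKRSpace Y,
      ∀ (X : Type u) [TopologicalSpace X] [T35Space X], IsKRSpace X → IsKRSpace (X × Y),
      ∀ (X : Type u) [TopologicalSpace X] [T35Space X] [FrechetUrysohnSpace X],
        IsKRSpace (X × Y)] ∧
    (LocallyCompactSpace Y →
      ∀ (X : Type u) [TopologicalSpace X] [T35Space X], IsKRSpace X → IsKRSpace (X × Y)) := by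
  refine ⟨?_, fun _ X _ _ hX => hX.prod .of_weaklyLocallyCompactSpace
    .of_weaklyLocallyCompactSpace⟩
  tfae_have 1 → 2 := fun h X _ _ hX => hX.prod h.2 h.1
  tfae_have 2 → 3 := fun h X _ _ _ => h X .of_sequentialSpace
  tfae_have 3 → 1 := fun h =>
    -- Being indexed by sets of `Y`, the fan lies in the universe of `Y`.
    ⟨.of_isKRSpace_prod_sequentialFan fun _ => h _, .of_prod_punit (h PUnit)⟩
  tfae_finish
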